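/- Let $n\ge 2$, $\beta\in(0,1)$, and let $G=(V,E)$ be a directed graph without loops on the node set $V=\{1,\dots,n\}$. The polytope $\mathcal H_\beta(G)\subseteq\mathbb R^{E}$ is the set of all $x\ge 0$ with $$\sum_{j:(1,j)\in E}x_{1j}-\beta\sum_{j:(j,1)\in E}x_{j1}=1-\beta^n,\qquad \sum_{j:(i,j)\in E}x_{ij}-\beta\sum_{j:(j,i)\in E}x_{ji}=0\quad(i\in V\setminus\{1\}),\qquad \sum_{j:(1,j)\in E}x_{1j}=1;$$ write these $n+1$ equations as $Ax=b$, so that the columns of $A$ are indexed by the arcs of $G$. A feasible basis of $\mathcal H_\beta(G)$ is a set $B\subseteq E$ of $n+1$ arcs such that the corresponding columns of $A$ form a nonsingular matrix $A_B$ and $A_B^{-1}b\ge 0$; its extreme point is the point $x\in\mathcal H_\beta(G)$ with coordinates $A_B^{-1}b$ on $B$ and $0$ elsewhere, and the support of $x$ is the graph on $V$ with arc set $\{(i,j)\in E: x_{ij}>0\}$. The basis $B$ is called Hamiltonian if this support is a Hamiltonian cycle of $G$ (a directed cycle through all $n$ nodes), and of Type 4 if the support is not a Hamiltonian cycle and at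 least one node has degree zero in it. Let $G_{n,p}$ be the directed binomial random graph on $n$ nodes, in which each ordered pair of distinct nodes is an arc independently with probability $p$. Then there is an $N$ such that for all $n\ge N$, all $\beta\in(0,1)$ and all $p\in(0,1]$, the feasible bases of the random polytope $\mathcal H_\beta(G_{n,p})$ satisfy $$\text{(i)}\quad \frac{\mathbf E[\text{number of feasible bases of Type 4}]}{\mathbf E[\text{total number of feasible bases}]}\ \ge\ 1-\frac{n^{11/2}}{e^{n}\,2^{n-9}},$$ $$\text{(ii)}\quad \frac{\mathbf E[\text{number of Hamiltonian bases}]}{\mathbf E[\text{total number of feasible bases}]}\ \le\ \frac{n^{9/2}}{e^{n-1}\,2^{n-9}}.$$ -/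

import Mathlib

open MeasureTheory ProbabilityTheory

noncomputable section

namespace HBeta

/-- The arcs of the complete directed graph on `n` nodes: the ordered pairs of distinct nodes.
The node set is `Fin n`, and the node `1` of the usual numbering is the element `0` of `Fin n`.
A directed graph on these nodes is given by its set of arcs `E : Set (Arc n)`. -/
abbrev Arc (n : ℕ) : Type := {e : Fin n × Fin n // e.1 ≠ e.2}

/-- The node that an arc leaves. -/
def Arc.tail {n : ℕ} (e : Arc n) : Fin n := e.1.1

/-- The node that an arc enters. -/
def Arc.head {n : ℕ} (e : Arc n) : Fin n := e.1.2

/-- The constraint matrix of the polytope of the complete directed graph. The row `Sum.inl i` is the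
discounted flow balance `∑_j x_{ij} - β ∑_j x_{ji}` at the node `i`, and the last row
`Sum.inr ()` is the total flow `∑_j x_{1j}` out of the first node. The constraint matrix of a
digraph `E` consists of the columns that belong to the arcs in `E`. -/
def constraintMatrix (n : ℕ) (β : ℝ) : Matrix (Fin n ⊕ Unit) (Arc n) ℝ :=
  Matrix.of fun r e =>
    match r with
    | Sum.inl i => (if e.tail = i then 1 else 0) - β * (if e.head = i then 1 else 0)
    | Sum.inr _ => if (e.tail : ℕ) = 0 then 1 else 0

/-- The right-hand side of the constraints: `1 - β ^ n` for the balance at the first node, `0` for the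
balance at every other node, and `1` for the total flow out of the first node. -/
def rhs (n : ℕ) (β : ℝ) : Fin n ⊕ Unit → ℝ
  | Sum.inl i => if (i : ℕ) = 0 then 1 - β ^ n else 0
  | Sum.inr _ => 1

/-- The polytope `H_β(E)` of the digraph `E`. A vector indexed by the arcs in `E` is represented by
the vector indexed by all arcs that extends it by zero. -/
def polytope {n : ℕ} (β : ℝ) (E : Set (Arc n)) : Set (Arc n → ℝ) :=
  {x | (constraintMatrix n β).mulVec x = rhs n β ∧ (∀ e, 0 ≤ x e) ∧ ∀ e, e ∉ E → x e = 0}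

/-- The set `B` of `n + 1` arcs of `E` is a feasible basis of `H_β(E)` with corresponding extreme
point `x`: the columns of the constraint matrix that belong to `B` are linearly independent (so that
`A_B` is a nonsingular square matrix), and `x` is a point of the polytope whose coordinates
outside `B` vanish (so that its coordinates in `B` are `A_B⁻¹ b`). -/
structure IsBasisOf {n : ℕ} (β : ℝ) (E : Set (Arc n)) (B : Finset (Arc n)) (x : Arc n → ℝ) :
    Prop where
  subset : (B : Set (Arc n)) ⊆ E
  card : B.card = n + 1
  linearIndependent :
    LinearIndependent ℝ (fun e : B => (constraintMatrix n β).col (e : Arc n))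
  mem : x ∈ polytope β E
  eq_zero : ∀ e, e ∉ B → x e = 0

/-- The extreme point that corresponds to a feasible basis is unique. -/
theorem IsBasisOf.unique {n : ℕ} {β : ℝ} {E : Set (Arc n)} {B : Finset (Arc n)}
    {x y : Arc n → ℝ} (hx : IsBasisOf β E B x) (hy : IsBasisOf β E B y) : x = y := by
  have key : ∑ e : B, (x e - y e) • (constraintMatrix n β).col (e : Arc n) = 0 := by
    have h : (constraintMatrix n β).mulVec (x - y) = 0 := by
      rw [Matrix.mulVec_sub, hx.mem.1, hy.mem.1, sub_self]
    rw [← h]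
    funext r
    simp only [Finset.sum_apply, Pi.smul_apply, smul_eq_mul, Matrix.mulVec, dotProduct,
      Matrix.col_apply, Pi.sub_apply]
    rw [Finset.sum_coe_sort B (fun e => (x e - y e) * constraintMatrix n β r e)]
    rw [← Finset.sum_subset (Finset.subset_univ B)]
    · exact Finset.sum_congr rfl fun e _ => mul_comm _ _
    · intro e _ he
      simp [hx.eq_zero e he, hy.eq_zero e he]
  have h0 := Fintype.linearIndependent_iff.1 hx.linearIndependent (fun e => x e - y e) key
  funext e
  by_cases he : e ∈ B
  · exact sub_eq_zero.1 (h0 ⟨e, he⟩)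
  · rw [hx.eq_zero e he, hy.eq_zero e he]

/-- The arc set of the support of `x`. -/
def supp {n : ℕ} (x : Arc n → ℝ) : Set (Arc n) := {e | x e ≠ 0}

/-- The arc set `S` is a Hamiltonian cycle: it consists of the arcs `(v, σ v)` for a permutation `σ`
of the nodes that moves all nodes around in one single cycle. -/
def IsHamiltonianCycle {n : ℕ} (S : Set (Arc n)) : Prop :=
  ∃ σ : Equiv.Perm (Fin n), σ.IsCycleOn Set.univ ∧ S = {e | σ e.tail = e.head}

/-- In the graph with arc set `S`, the node `v` has degree zero. -/
def HasDegreeZero {n : ℕ} (S : Set (Arc n)) (v : Fin n) : Prop :=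
  ∀ e ∈ S, e.tail ≠ v ∧ e.head ≠ v

/-- `B` is a feasible basis of `H_β(E)`. -/
def IsFeasibleBasis {n : ℕ} (β : ℝ) (E : Set (Arc n)) (B : Finset (Arc n)) : Prop :=
  ∃ x, IsBasisOf β E B x

/-- `B` is a Hamiltonian basis of `H_β(E)`: the support of the corresponding extreme point is a
Hamiltonian cycle. -/
def IsHamiltonianBasis {n : ℕ} (β : ℝ) (E : Set (Arc n)) (B : Finset (Arc n)) : Prop :=
  ∃ x, IsBasisOf β E B x ∧ IsHamiltonianCycle (supp x)

/-- `B` is a feasible basis of `H_β(E)` of Type 4: the corresponding extreme point is not Hamiltonian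
and at least one node has degree zero in its support. -/
def IsTypeFourBasis {n : ℕ} (β : ℝ) (E : Set (Arc n)) (B : Finset (Arc n)) : Prop :=
  ∃ x, IsBasisOf β E B x ∧ ¬ IsHamiltonianCycle (supp x) ∧ ∃ v, HasDegreeZero (supp x) v

/-- The directed binomial random graph on `n` nodes, as a law on arc sets: every ordered pair of
distinct nodes is an arc with probability `p`, independently of the others. -/
def binomialDigraph (n : ℕ) (p : unitInterval) : Measure (Set (Arc n)) :=
  setBernoulli Set.univ p

/-- The expected number of arc sets `B` with the property `P E B` for the random digraph `E`. -/
def expectedCount (n : ℕ) (p : unitInterval) (P : Set (Arc n) → Finset (Arc n) → Prop) : ℝ :=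
  ∫ E, ({B | P E B}.ncard : ℝ) ∂binomialDigraph n p

end HBeta

end

/-! A basis depends on the digraph `E` only through `B ⊆ E`, so each expected count is `p ^ (n + 1)`
times a count for the complete digraph, and both ratios become deterministic. The total is bounded
below by bases whose extreme point is supported on the 2-cycles `0 ↔ a` and `a ↔ w`. Any forest
rooted at `{0, a, w}`, with its arcs directed arbitrarily, completes these four arcs to a basis
(`isBasisOf_corePoint`). There are `3 * n ^ (n - 4)` such forests by a matrix-tree argument, `2 ^ (n
- 3)` orientations and `(n - 1) * (n - 2)` choices of `a, w`. If the support has no node of degree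
zero, flow balance forces an arc into and an arc out of every node. A set of `n + 1` arcs with this
property is nearly the graph of a permutation, so at most `n! * n ^ 3` bases are not of Type 4. A
Hamiltonian basis is a cycle plus one arc, hence at most `n! * n ^ 2` of them. Stirling's bound on
`n!` gives the stated ratios. -/

namespace HBeta

/-! ### Counting rooted forests by determinants. -/

section Forest

variable {V : Type*}

/-- The parent function `f` describes a forest with root set `R`: some rank function decreases
from every node that is not a root to its parent. -/
def IsForest (R : Finset V) (f : {v // v ∉ R} → V) : Prop :=
  ∃ h : V → ℕ, ∀ v : {v // v ∉ R}, h (f v) < h v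

theorem IsForest.ne {R : Finset V} {f : {v // v ∉ R} → V} (hf : IsForest R f)
    (v : {v // v ∉ R}) : f v ≠ v := by
  obtain ⟨h, hh⟩ := hf
  intro e
  have := hh v
  rw [e] at this
  exact lt_irrefl _ this

variable [Fintype V] [DecidableEq V]

/-- The Laplacian of a parent function, with the rows and columns of the roots deleted. -/
def parentMatrix (R : Finset V) (f : {v // v ∉ R} → V) :
    Matrix {v // v ∉ R} {v // v ∉ R} ℝ :=
  Matrix.of fun v u => (if u = v then 1 else 0) - if f v = u then 1 else 0

/-- Ordering the nodes by rank makes the matrix block triangular. No parent has the same rank as its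
child, so the diagonal blocks are identities. -/
theorem IsForest.det_parentMatrix {R : Finset V} {f : {v // v ∉ R} → V} (hf : IsForest R f) :
    (parentMatrix R f).det = 1 := by
  have hne := hf.ne
  obtain ⟨h, hh⟩ := hf
  have htri : (parentMatrix R f).BlockTriangular
      (fun v => OrderDual.toDual (h (v : V))) := by
    intro i j hij
    have hij' : h i < h j := hij
    have h1 : j ≠ i := by rintro rfl; exact lt_irrefl _ hij'
    have h2 : f i ≠ j := by
      intro e
      have := hh i
      rw [e] at this
      omega
    simp [parentMatrix, h1, h2]
  rw [htri.det]
  refine Finset.prod_eq_one fun a _ => ?_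
  have : (parentMatrix R f).toSquareBlock (fun v => OrderDual.toDual (h (v : V))) a = 1 := by
    ext ⟨i, hi⟩ ⟨j, hj⟩
    have h2 : f i ≠ j := by
      intro e
      have h3 := hh i
      have h4 : h i = h j := OrderDual.toDual.injective (hi.trans hj.symm)
      rw [e] at h3
      omega
    rcases eq_or_ne i j with rfl | hij
    · simp [parentMatrix, Matrix.toSquareBlock_def, h2]
    · simp [parentMatrix, Matrix.toSquareBlock_def, h2, hij, hij.symm]
  rw [this, Matrix.det_one]

/-- The nodes that never reach `R` under iterated parents have an indicator vector in the kernel, so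
there are none; the number of steps to `R` is then a rank function. -/
theorem isForest_of_det_ne_zero {R : Finset V} {f : {v // v ∉ R} → V}
    (hf : (parentMatrix R f).det ≠ 0) : IsForest R f := by
  let F : V → V := fun v => if hv : v ∈ R then v else f ⟨v, hv⟩
  have hF : ∀ v : {v // v ∉ R}, F v = f v := fun v => dif_neg v.2
  have hreach : ∀ v, ∃ k, F^[k] v ∈ R := by
    by_contra! hcon
    obtain ⟨v₀, hv₀⟩ := hcon
    apply hf
    classical
    apply Matrix.exists_mulVec_eq_zero_iff.1
    refine ⟨fun v => if ∀ k, F^[k] v ∉ R then 1 else 0, ?_, ?_⟩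
    · intro h
      have := congrFun h ⟨v₀, hv₀ 0⟩
      simp [hv₀] at this
    · funext v
      have hiff : (∀ k, F^[k] (v : V) ∉ R) ↔ ∀ k, F^[k] (f v) ∉ R := by
        constructor
        · intro h k
          have := h (k + 1)
          rwa [Function.iterate_succ_apply, hF] at this
        · rintro h (_ | k)
          · exact v.2
          · rw [Function.iterate_succ_apply, hF]
            exact h k
      simp only [Matrix.mulVec, dotProduct, parentMatrix, Matrix.of_apply, sub_mul, ite_mul, one_mul,
        zero_mul, Finset.sum_sub_distrib, Finset.sum_ite_eq', Finset.mem_univ, if_true,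
        Pi.zero_apply]
      by_cases hv : f v ∈ R
      · have h1 : ∀ u : {v // v ∉ R}, f v ≠ u := fun u e => u.2 (e ▸ hv)
        have h2 : ¬ ∀ k, F^[k] (v : V) ∉ R := fun h => hiff.1 h 0 hv
        rw [if_neg h2]
        simp [h1]
      · rw [Finset.sum_eq_single (⟨f v, hv⟩ : {v // v ∉ R})]
        · simp [hiff]
        · intro u _ hu
          rw [if_neg]
          rintro e
          exact hu (Subtype.ext e.symm)
        · simp
  classical
  refine ⟨fun v => Nat.find (hreach v), fun v => ?_⟩
  have hpos : Nat.find (hreach v) ≠ 0 := by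
    intro h
    have := Nat.find_spec (hreach v)
    rw [h] at this
    exact v.2 this
  obtain ⟨k, hk⟩ := Nat.exists_eq_succ_of_ne_zero hpos
  have h1 := Nat.find_spec (hreach v)
  rw [hk, Function.iterate_succ_apply, hF] at h1
  have h2 : Nat.find (hreach (f v)) ≤ k := Nat.find_min' _ h1
  show Nat.find (hreach (f v)) < Nat.find (hreach v)
  omega

/-- The determinant is multilinear in the rows and row `v` depends only on `f v`, so the sum over
all `f` can be taken row by row. -/
theorem sum_det_parentMatrix (R : Finset V) :
    ∑ f, (parentMatrix R f).det =
      (Matrix.of fun v u : {v // v ∉ R} =>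
        (Fintype.card V : ℝ) * (if u = v then 1 else 0) - 1).det := by
  have key := (Matrix.detRowAlternating (R := ℝ) (n := {v // v ∉ R})).toMultilinearMap.map_sum
    (fun (v : {v // v ∉ R}) (y : V) (u : {v // v ∉ R}) =>
      (if u = v then (1 : ℝ) else 0) - if y = u then 1 else 0)
  refine Eq.trans ?_ (key.symm.trans ?_)
  · rfl
  · refine congrArg Matrix.det ?_
    ext v u
    simp [Finset.sum_apply]

/-- The all-ones matrix has rank one, so `det (1 - A * B) = det (1 - B * A)` reduces the determinant
to size one. -/
theorem det_const_mul_one_sub_one {ι : Type*} [Fintype ι] [DecidableEq ι] {c : ℝ} (hc : c ≠ 0) :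
    (Matrix.of fun v u : ι => c * (if u = v then 1 else 0) - 1).det =
      c ^ Fintype.card ι * (1 - Fintype.card ι / c) := by
  have h : (Matrix.of fun v u : ι => c * (if u = v then 1 else 0) - 1) =
      c • (1 - Matrix.replicateCol Unit (fun _ : ι => c⁻¹) *
        Matrix.replicateRow Unit fun _ : ι => (1 : ℝ)) := by
    ext v u
    by_cases huv : u = v
    · simp [Matrix.mul_apply, huv, hc, mul_sub]
    · simp [Matrix.mul_apply, huv, hc, Ne.symm huv]
  rw [h, Matrix.det_smul, Matrix.det_one_sub_mul_comm]
  congr 1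
  rw [Matrix.det_unique]
  simp [Matrix.mul_apply, div_eq_mul_inv]

/-- A lower bound for the number of rooted forests with a given set of roots. -/
theorem le_card_isForest (R : Finset V) (hV : Fintype.card V ≠ 0) :
    (Fintype.card V : ℝ) ^ (Fintype.card V - R.card) * (R.card / Fintype.card V) ≤
      Nat.card {f : {v // v ∉ R} → V // IsForest R f} := by
  classical
  have hV' : (Fintype.card V : ℝ) ≠ 0 := Nat.cast_ne_zero.2 hV
  have hcard : Fintype.card {v // v ∉ R} = Fintype.card V - R.card := by
    simp
  have hle : R.card ≤ Fintype.card V := Finset.card_le_univ R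
  have h1 := sum_det_parentMatrix R
  rw [det_const_mul_one_sub_one hV', hcard, Nat.cast_sub hle, sub_div, div_self hV',
    sub_sub_cancel] at h1
  rw [← h1, Nat.card_eq_fintype_card, Fintype.card_subtype, Finset.card_eq_sum_ones,
    Nat.cast_sum, Finset.sum_filter]
  -- Each determinant is 1 on forests and 0 otherwise.
  refine Finset.sum_le_sum fun f _ => ?_
  by_cases hf : IsForest R f
  · simp [hf, hf.det_parentMatrix]
  · have : (parentMatrix R f).det = 0 := not_not.1 (mt isForest_of_det_ne_zero hf)
    simp [hf, this]

end Forest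

/-! ### Feasible bases built on two 2-cycles. -/

section ShortCycle

variable {n : ℕ}

theorem constraintMatrix_inl (β : ℝ) (i : Fin n) (e : Arc n) :
    constraintMatrix n β (Sum.inl i) e =
      (if e.tail = i then 1 else 0) - β * (if e.head = i then 1 else 0) := rfl

/-- The coordinates of the extreme point supported by the two 2-cycles. -/
noncomputable def coreValue (n : ℕ) (β : ℝ) : Fin 4 → ℝ :=
  ![1, β ^ (n - 1), (β - β ^ (n - 1)) / (1 - β ^ 2), β * ((β - β ^ (n - 1)) / (1 - β ^ 2))]

theorem coreValue_pos {β : ℝ} (h0 : 0 < β) (h1 : β < 1) (hn : 3 ≤ n) (i : Fin 4) :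
    0 < coreValue n β i := by
  have h2 : 0 < 1 - β ^ 2 := by nlinarith
  have h3 : 0 < β - β ^ (n - 1) := by
    have := pow_lt_pow_right_of_lt_one₀ h0 h1 (show 1 < n - 1 by omega)
    rw [pow_one] at this
    linarith
  have h4 : 0 < (β - β ^ (n - 1)) / (1 - β ^ 2) := div_pos h3 h2
  fin_cases i
  · exact one_pos
  · exact pow_pos h0 _
  · exact h4
  · exact mul_pos h0 h4

variable [NeZero n]

theorem constraintMatrix_inr (β : ℝ) (u : Unit) (e : Arc n) :
    constraintMatrix n β (Sum.inr u) e = if e.tail = 0 then 1 else 0 := by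
  simp only [constraintMatrix, Matrix.of_apply, ← Fin.val_eq_zero_iff]

/-- The arcs of the 2-cycles `0 → a → 0` and `a → w → a`. -/
def coreArc (a w : Fin n) (ha : a ≠ 0) (hw : w ≠ a) : Fin 4 → Arc n :=
  ![⟨(0, a), ha.symm⟩, ⟨(a, 0), ha⟩, ⟨(a, w), hw.symm⟩, ⟨(w, a), hw⟩]

/-- The arcs between the nodes outside `R` and their parents under `f`, directed by `o`. -/
def pendantArc {R : Finset (Fin n)} (f : {v // v ∉ R} → Fin n) (hf : ∀ v, f v ≠ v)
    (o : {v // v ∉ R} → Bool) (v : {v // v ∉ R}) : Arc n :=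
  if o v then ⟨(v, f v), (hf v).symm⟩ else ⟨(f v, v), hf v⟩

/-- The arcs of the two 2-cycles on `0, a, w` and of an oriented forest attached to them. -/
def basisArc (a w : Fin n) (ha : a ≠ 0) (hw : w ≠ a)
    (f : {v // v ∉ ({0, a, w} : Finset (Fin n))} → Fin n) (hf : ∀ v, f v ≠ v)
    (o : {v // v ∉ ({0, a, w} : Finset (Fin n))} → Bool) :
    Fin 4 ⊕ {v // v ∉ ({0, a, w} : Finset (Fin n))} → Arc n :=
  Sum.elim (coreArc a w ha hw) (pendantArc f hf o)

/-- Forest arcs are eliminated from the leaves inwards by the balance rows of their child nodes; the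
four core arcs remain and are handled directly. -/
theorem linearIndependent_basisArc {β : ℝ} (h0 : 0 < β) (h1 : β < 1) {a w : Fin n} (ha : a ≠ 0)
    (hw : w ≠ a) (hw0 : w ≠ 0) {f : {v // v ∉ ({0, a, w} : Finset (Fin n))} → Fin n}
    (hf : IsForest _ f) (o : {v // v ∉ ({0, a, w} : Finset (Fin n))} → Bool) :
    LinearIndependent ℝ
      (fun i => (constraintMatrix n β).col (basisArc a w ha hw f hf.ne o i)) := by
  rw [Fintype.linearIndependent_iff]
  intro g hg
  have hrow : ∀ r, ∑ i, g (Sum.inl i) * constraintMatrix n β r (coreArc a w ha hw i) +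
      ∑ v, g (Sum.inr v) * constraintMatrix n β r (pendantArc f hf.ne o v) = 0 := by
    intro r
    have := congrFun hg r
    simpa [Fintype.sum_sum_type, Finset.sum_apply, basisArc, Fin.sum_univ_four] using this
  obtain ⟨h, hh⟩ := id hf
  have hpend : ∀ v, g (Sum.inr v) = 0 := by
    by_contra! hcon
    obtain ⟨v₀, hv₀⟩ := hcon
    -- At a node `v` of maximal rank among the nonzero coefficients, no other arc in play touches
    -- `v`. Row `v` thus contains only its own arc, with entry `1` or `-β`.
    obtain ⟨v, hv, hmax⟩ := Finset.exists_max_image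
      (Finset.univ.filter fun v => g (Sum.inr v) ≠ 0) (fun v => h (v : Fin n))
      ⟨v₀, by simpa using hv₀⟩
    simp only [Finset.mem_filter, Finset.mem_univ, true_and] at hv hmax
    have hvR := v.2
    simp only [Finset.mem_insert, Finset.mem_singleton, not_or] at hvR
    have hr := hrow (Sum.inl v)
    rw [Fin.sum_univ_four, Finset.sum_eq_single v] at hr
    · apply hv
      have hne := hf.ne v
      simp only [coreArc, constraintMatrix_inl, Arc.tail, Arc.head, pendantArc] at hr
      rcases Bool.eq_false_or_eq_true (o v) with ho | ho
      · simpa [ho, hne, hvR.1, Ne.symm hvR.1, Ne.symm hvR.2.1, Ne.symm hvR.2.2] using hr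
      · simpa [ho, hne, hvR.1, Ne.symm hvR.1, Ne.symm hvR.2.1, Ne.symm hvR.2.2, h0.ne'] using hr
    · intro u _ hu
      by_cases hgu : g (Sum.inr u) = 0
      · rw [hgu, zero_mul]
      · have hfu : f u ≠ v := by
          intro e
          have h2 := hh u
          rw [e] at h2
          exact absurd (hmax u hgu) (not_le.2 h2)
        have huv : (u : Fin n) ≠ v := fun e => hu (Subtype.ext e)
        simp only [constraintMatrix_inl, Arc.tail, Arc.head, pendantArc]
        rcases Bool.eq_false_or_eq_true (o u) with ho | ho <;> simp [ho, hfu, huv]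
    · simp
  simp only [hpend, zero_mul, Finset.sum_const_zero, add_zero, Fin.sum_univ_four] at hrow
  -- The total-flow row kills `0 → a` and row `0` then kills `a → 0`. Rows `a` and `w` leave a 2 by
  -- 2 system of determinant `1 - β ^ 2`.
  have e1 := hrow (Sum.inr ())
  have e2 := hrow (Sum.inl 0)
  have e3 := hrow (Sum.inl a)
  have e4 := hrow (Sum.inl w)
  simp [coreArc, constraintMatrix_inr, Arc.tail, ha, hw0] at e1
  simp [coreArc, constraintMatrix_inl, Arc.tail, Arc.head, ha, hw0, e1, h0.ne'] at e2
  simp [coreArc, constraintMatrix_inl, Arc.tail, Arc.head, hw, e1, e2,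
    ha.symm] at e3
  simp [coreArc, constraintMatrix_inl, Arc.tail, Arc.head, hw.symm, e1, e2,
    hw0.symm] at e4
  have e5 : g (Sum.inl 2) = 0 := by
    have h3 : g (Sum.inl 2) * (1 - β ^ 2) = 0 := by linear_combination e3 + β * e4
    have h4 : (1 - β ^ 2) ≠ 0 := by nlinarith
    exact (mul_eq_zero.1 h3).resolve_right h4
  have e6 : g (Sum.inl 3) = 0 := by
    rw [e5] at e4
    linear_combination e4
  rintro (i | v)
  · fin_cases i
    exacts [e1, e2, e5, e6]
  · exact hpend v

/-- The extreme point supported by the two 2-cycles. -/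
noncomputable def corePoint (β : ℝ) (a w : Fin n) (ha : a ≠ 0) (hw : w ≠ a) : Arc n → ℝ :=
  ∑ i, Pi.single (coreArc a w ha hw i) (coreValue n β i)

theorem corePoint_apply (β : ℝ) (a w : Fin n) (ha : a ≠ 0) (hw : w ≠ a) (e : Arc n) :
    corePoint β a w ha hw e =
      ∑ i, if e = coreArc a w ha hw i then coreValue n β i else 0 := by
  simp [corePoint, Finset.sum_apply, Pi.single_apply]

theorem supp_corePoint {β : ℝ} (h0 : 0 < β) (h1 : β < 1) (hn : 3 ≤ n) {a w : Fin n} (ha : a ≠ 0)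
    (hw : w ≠ a) : supp (corePoint β a w ha hw) = Set.range (coreArc a w ha hw) := by
  ext e
  have hnn : ∀ i, 0 ≤ if e = coreArc a w ha hw i then coreValue n β i else 0 := fun i => by
    split_ifs
    exacts [(coreValue_pos h0 h1 hn i).le, le_rfl]
  simp only [supp, Set.mem_ofPred_eq, corePoint_apply, Set.mem_range]
  rw [Ne, Finset.sum_eq_zero_iff_of_nonneg fun i _ => hnn i]
  push Not
  constructor
  · rintro ⟨i, _, hi⟩
    by_contra! hcon
    exact hi (if_neg (hcon i).symm)
  · rintro ⟨i, rfl⟩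
    exact ⟨i, Finset.mem_univ _, by simpa using (coreValue_pos h0 h1 hn i).ne'⟩

/-- The values are forced: flow 1 leaves node `0`, so its balance requires inflow `β ^ (n - 1)`.
With `s` on `a → w` and `β * s` back, balance at `a` reads `s * (1 - β ^ 2) = β - β ^ (n - 1)`. -/
theorem constraintMatrix_mulVec_corePoint {β : ℝ} (h0 : 0 < β) (h1 : β < 1) (hn : 3 ≤ n)
    {a w : Fin n} (ha : a ≠ 0) (hw : w ≠ a) (hw0 : w ≠ 0) :
    (constraintMatrix n β).mulVec (corePoint β a w ha hw) = rhs n β := by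
  have h2 : 1 - β ^ 2 ≠ 0 := by nlinarith
  have hpow : β * β ^ (n - 1) = β ^ n := by
    rw [← pow_succ', Nat.sub_add_cancel (by omega)]
  have hrow : ∀ r, (constraintMatrix n β).mulVec (corePoint β a w ha hw) r =
      ∑ i, coreValue n β i * constraintMatrix n β r (coreArc a w ha hw i) := by
    intro r
    simp [corePoint, Matrix.mulVec_sum, Matrix.mulVec_single, Finset.sum_apply]
  have ht : (β - β ^ (n - 1)) / (1 - β ^ 2) * (1 - β ^ 2) = β - β ^ (n - 1) :=
    div_mul_cancel₀ _ h2
  funext r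
  rw [hrow, Fin.sum_univ_four]
  rcases r with i | u
  · by_cases hi0 : i = 0
    · subst hi0
      simp [coreArc, coreValue, constraintMatrix_inl, Arc.tail, Arc.head, rhs, ha, hw0]
      linear_combination -hpow
    · have hr : rhs n β (Sum.inl i) = 0 := if_neg fun h => hi0 (Fin.ext (by simpa using h))
      rw [hr]
      by_cases hia : i = a
      · subst hia
        simp [coreArc, coreValue, constraintMatrix_inl, Arc.tail, Arc.head, hw, ha.symm]
        linear_combination ht
      · by_cases hiw : i = w
        · subst hiw
          simp [coreArc, coreValue, constraintMatrix_inl, Arc.tail, Arc.head, hw.symm, hw0.symm]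
          ring
        · simp [coreArc, constraintMatrix_inl, Arc.tail, Arc.head, Ne.symm hi0, Ne.symm hia,
            Ne.symm hiw]
  · simp [coreArc, coreValue, constraintMatrix_inr, Arc.tail, rhs, ha, hw0]

theorem isBasisOf_corePoint {β : ℝ} (h0 : 0 < β) (h1 : β < 1) (hn : 3 ≤ n) {a w : Fin n}
    (ha : a ≠ 0) (hw : w ≠ a) (hw0 : w ≠ 0)
    {f : {v // v ∉ ({0, a, w} : Finset (Fin n))} → Fin n}
    (hf : IsForest _ f) (o : {v // v ∉ ({0, a, w} : Finset (Fin n))} → Bool) :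
    IsBasisOf β Set.univ (Finset.univ.image (basisArc a w ha hw f hf.ne o))
      (corePoint β a w ha hw) := by
  have hli := linearIndependent_basisArc h0 h1 ha hw hw0 hf o
  -- Independent columns are distinct, so the image really has `4 + (n - 3) = n + 1` arcs.
  have hinj : Function.Injective (basisArc a w ha hw f hf.ne o) := fun i j hij =>
    hli.injective (by simp only [hij])
  refine ⟨Set.subset_univ _, ?_, ?_, ⟨?_, ?_, fun e he => absurd (Set.mem_univ e) he⟩, ?_⟩
  · have h3 : ({0, a, w} : Finset (Fin n)).card = 3 := by
      rw [Finset.card_eq_three]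
      exact ⟨0, a, w, ha.symm, hw0.symm, hw.symm, rfl⟩
    rw [Finset.card_image_of_injective _ hinj, Finset.card_univ, Fintype.card_sum,
      Fintype.card_fin, Fintype.card_subtype_compl, Fintype.card_coe, Fintype.card_fin, h3]
    omega
  · have := (linearIndepOn_range_iff hinj _).2 hli
    rw [← Set.image_univ, ← Finset.coe_univ, ← Finset.coe_image] at this
    exact this
  · exact constraintMatrix_mulVec_corePoint h0 h1 hn ha hw hw0
  · intro e
    rw [corePoint_apply]
    refine Finset.sum_nonneg fun i _ => ?_
    split_ifs
    exacts [(coreValue_pos h0 h1 hn i).le, le_rfl]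
  · intro e he
    by_contra hne
    have : e ∈ supp (corePoint β a w ha hw) := hne
    rw [supp_corePoint h0 h1 hn] at this
    obtain ⟨i, rfl⟩ := this
    exact he (Finset.mem_image.2 ⟨Sum.inl i, Finset.mem_univ _, rfl⟩)

end ShortCycle

/-! ### Lower bound for the number of feasible bases. -/

section LowerBound

variable {n : ℕ}

/-- An oriented forest is determined by its arcs. -/
theorem pendantArc_injective {R : Finset (Fin n)} {f f' : {v // v ∉ R} → Fin n}
    (hf : IsForest R f) (hf' : ∀ v, f' v ≠ v) {o o' : {v // v ∉ R} → Bool}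
    (hsub : ∀ v, ∃ u, pendantArc f hf.ne o v = pendantArc f' hf' o' u) : f = f' ∧ o = o' := by
  obtain ⟨h, hh⟩ := id hf
  have key : ∀ k, ∀ v : {v // v ∉ R}, h v = k → f v = f' v ∧ o v = o' v := by
    intro k
    induction k using Nat.strong_induction_on with
    | _ k ih =>
      intro v hk
      obtain ⟨u, hu⟩ := hsub v
      have hne := hf.ne v
      have hcase : ((v : Fin n) = u ∧ f v = f' u ∧ o v = o' u) ∨ ((v : Fin n) = f' u ∧ f v = u) := by
        unfold pendantArc at hu
        rcases Bool.eq_false_or_eq_true (o v) with h1 | h1 <;>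
        rcases Bool.eq_false_or_eq_true (o' u) with h2 | h2 <;>
        simp [h1, h2] at hu ⊢ <;> grind
      rcases hcase with ⟨h1, h2, h3⟩ | ⟨h1, h2⟩
      · have : v = u := Subtype.ext h1
        subst this
        exact ⟨h2, h3⟩
      -- Here the two forests traverse the same arc in opposite senses. Since `u` has smaller rank
      -- than `v`, induction gives `f u = f' u = v`, so `v` also has smaller rank than `u`.
      · have h3 := hh v
        rw [h2] at h3
        have h4 := (ih (h u) (hk ▸ h3) u rfl).1
        have h5 := hh u
        rw [h4, ← h1] at h5
        omega
  exact ⟨funext fun v => (key _ v rfl).1, funext fun v => (key _ v rfl).2⟩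

variable [NeZero n]

/-- The arcs of the 2-cycles `0 → a → 0` and `a → w → a`, as a set. -/
def coreSet (a w : Fin n) : Set (Arc n) :=
  {e | e.1 = (0, a) ∨ e.1 = (a, 0) ∨ e.1 = (a, w) ∨ e.1 = (w, a)}

theorem range_coreArc {a w : Fin n} (ha : a ≠ 0) (hw : w ≠ a) :
    Set.range (coreArc a w ha hw) = coreSet a w := by
  ext e
  simp only [coreArc, coreSet, Set.mem_range, Set.mem_ofPred_eq, Fin.exists_fin_succ,
    Fin.exists_fin_zero, Subtype.ext_iff]
  simp [eq_comm]

theorem coreSet_injective {a w a' w' : Fin n} (ha : a ≠ 0) (hw : w ≠ a) (hw0 : w ≠ 0)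
    (ha' : a' ≠ 0) (h : coreSet a w = coreSet a' w') : a = a' ∧ w = w' := by
  have h1 : (⟨(0, a), ha.symm⟩ : Arc n) ∈ coreSet a' w' := by
    rw [← h]
    exact Or.inl rfl
  have h2 : (⟨(a, w), hw.symm⟩ : Arc n) ∈ coreSet a' w' := by
    rw [← h]
    exact Or.inr (Or.inr (Or.inl rfl))
  simp only [coreSet, Set.mem_ofPred_eq, Prod.mk.injEq] at h1 h2
  grind

/-- The feasible bases whose extreme point is supported by the two 2-cycles on `0, a, w`. -/
def coreBases (β : ℝ) (a w : Fin n) : Set (Finset (Arc n)) :=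
  {B | ∃ x, IsBasisOf β Set.univ B x ∧ supp x = coreSet a w}

/-- A forest arc has an end outside `{0, a, w}`, so it is never a core arc and must be a forest arc
of the other basis. -/
theorem basisArc_image_injective {a w : Fin n} (ha : a ≠ 0) (hw : w ≠ a)
    {f f' : {v // v ∉ ({0, a, w} : Finset (Fin n))} → Fin n} (hf : IsForest _ f)
    (hf' : IsForest _ f') {o o' : {v // v ∉ ({0, a, w} : Finset (Fin n))} → Bool}
    (h : Finset.univ.image (basisArc a w ha hw f hf.ne o) =
      Finset.univ.image (basisArc a w ha hw f' hf'.ne o')) : f = f' ∧ o = o' := by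
  refine pendantArc_injective hf hf'.ne fun v => ?_
  have h1 : pendantArc f hf.ne o v ∈ Finset.univ.image (basisArc a w ha hw f' hf'.ne o') := by
    rw [← h]
    exact Finset.mem_image.2 ⟨Sum.inr v, Finset.mem_univ _, rfl⟩
  obtain ⟨i | u, _, hu⟩ := Finset.mem_image.1 h1
  · exfalso
    have h2 : pendantArc f hf.ne o v ∈ coreSet a w := by
      rw [← range_coreArc ha hw]
      exact ⟨i, hu⟩
    have hv := v.2
    simp only [Finset.mem_insert, Finset.mem_singleton, not_or] at hv
    unfold pendantArc at h2
    rcases Bool.eq_false_or_eq_true (o v) with h3 | h3 <;>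
    simp [h3, coreSet] at h2 <;> grind
  · exact ⟨u, hu.symm⟩

theorem le_ncard_coreBases {β : ℝ} (h0 : 0 < β) (h1 : β < 1) (hn : 3 ≤ n) {a w : Fin n}
    (ha : a ≠ 0) (hw : w ≠ a) (hw0 : w ≠ 0) :
    (n : ℝ) ^ (n - 3) * (3 / n) * 2 ^ (n - 3) ≤ ((coreBases β a w).ncard : ℝ) := by
  have h3 : ({0, a, w} : Finset (Fin n)).card = 3 := by
    rw [Finset.card_eq_three]
    exact ⟨0, a, w, ha.symm, hw0.symm, hw.symm, rfl⟩
  have hF := le_card_isForest ({0, a, w} : Finset (Fin n)) (by simp; omega)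
  rw [h3, Fintype.card_fin] at hF
  have hO : Nat.card ({v // v ∉ ({0, a, w} : Finset (Fin n))} → Bool) = 2 ^ (n - 3) := by
    rw [Nat.card_eq_fintype_card, Fintype.card_fun, Fintype.card_bool, Fintype.card_subtype_compl,
      Fintype.card_coe, Fintype.card_fin, h3]
  let Φ : {f : {v // v ∉ ({0, a, w} : Finset (Fin n))} → Fin n // IsForest _ f} ×
      ({v // v ∉ ({0, a, w} : Finset (Fin n))} → Bool) → coreBases β a w := fun q =>
    ⟨Finset.univ.image (basisArc a w ha hw q.1.1 q.1.2.ne q.2), corePoint β a w ha hw,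
      isBasisOf_corePoint h0 h1 hn ha hw hw0 q.1.2 q.2, by
        rw [supp_corePoint h0 h1 hn, range_coreArc]⟩
  have hΦ : Function.Injective Φ := by
    rintro ⟨⟨f, hf⟩, o⟩ ⟨⟨f', hf'⟩, o'⟩ h
    obtain ⟨rfl, rfl⟩ := basisArc_image_injective ha hw hf hf' (congrArg Subtype.val h)
    rfl
  have hle := Nat.card_le_card_of_injective Φ hΦ
  rw [Nat.card_prod, hO, Nat.card_coe_set_eq] at hle
  calc (n : ℝ) ^ (n - 3) * (3 / n) * 2 ^ (n - 3)
      ≤ (Nat.card {f : {v // v ∉ ({0, a, w} : Finset (Fin n))} → Fin n // IsForest _ f} : ℝ) *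
        2 ^ (n - 3) := by
        gcongr
        exact_mod_cast hF
    _ ≤ _ := by exact_mod_cast hle

/-- A lower bound for the number of feasible bases of the complete digraph. -/
theorem le_ncard_isFeasibleBasis {β : ℝ} (h0 : 0 < β) (h1 : β < 1) (hn : 3 ≤ n) :
    ((n : ℝ) - 1) * (n - 2) * ((n : ℝ) ^ (n - 3) * (3 / n) * 2 ^ (n - 3)) ≤
      ({B : Finset (Arc n) | IsFeasibleBasis β Set.univ B}.ncard : ℝ) := by
  classical
  let P : Finset (Fin n × Fin n) := (Finset.univ.erase (0 : Fin n)).offDiag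
  have hP : ∀ p ∈ P, p.1 ≠ 0 ∧ p.2 ≠ 0 ∧ p.2 ≠ p.1 := by
    intro p hp
    simp only [P, Finset.mem_offDiag, Finset.mem_erase, Finset.mem_univ, and_true] at hp
    exact ⟨hp.1, hp.2.1, hp.2.2.symm⟩
  have hPcard : (P.card : ℝ) = ((n : ℝ) - 1) * (n - 2) := by
    have hc : (Finset.univ.erase (0 : Fin n)).card = n - 1 := by simp
    rw [Finset.offDiag_card, hc]
    obtain ⟨k, rfl⟩ : ∃ k, n = k + 3 := ⟨n - 3, by omega⟩
    have : (k + 3 - 1) * (k + 3 - 1) - (k + 3 - 1) = (k + 2) * (k + 1) := by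
      rw [show k + 3 - 1 = k + 2 from rfl, show (k + 2) * (k + 2) = (k + 2) * (k + 1) + (k + 2) by ring,
        Nat.add_sub_cancel]
    rw [this]
    push_cast
    ring
  let S : Fin n × Fin n → Finset (Finset (Arc n)) := fun p => (coreBases β p.1 p.2).toFinset
  -- A basis determines its extreme point, whose support determines `a` and `w`.
  have hdisj : (P : Set (Fin n × Fin n)).PairwiseDisjoint S := by
    intro p hp q hq hpq
    refine Finset.disjoint_left.2 fun B hB hB' => hpq ?_
    obtain ⟨x, hx, hsx⟩ := Set.mem_toFinset.1 hB
    obtain ⟨y, hy, hsy⟩ := Set.mem_toFinset.1 hB'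
    rw [hx.unique hy, hsy] at hsx
    obtain ⟨h2, h3, h4⟩ := hP q hq
    obtain ⟨h5, h6⟩ := coreSet_injective h2 h4 h3 (hP p hp).1 hsx
    exact (Prod.ext h5 h6).symm
  have hsub : P.biUnion S ⊆ {B : Finset (Arc n) | IsFeasibleBasis β Set.univ B}.toFinset := by
    intro B hB
    obtain ⟨p, _, hp⟩ := Finset.mem_biUnion.1 hB
    obtain ⟨x, hx, _⟩ := Set.mem_toFinset.1 hp
    exact Set.mem_toFinset.2 ⟨x, hx⟩
  have hle := Finset.card_le_card hsub
  rw [Finset.card_biUnion fun p hp q hq hpq => hdisj hp hq hpq, ← Set.ncard_eq_toFinset_card'] at hle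
  calc ((n : ℝ) - 1) * (n - 2) * ((n : ℝ) ^ (n - 3) * (3 / n) * 2 ^ (n - 3))
      = ∑ p ∈ P, (n : ℝ) ^ (n - 3) * (3 / n) * 2 ^ (n - 3) := by
        rw [Finset.sum_const, nsmul_eq_mul, hPcard]
    _ ≤ ∑ p ∈ P, ((S p).card : ℝ) := by
        refine Finset.sum_le_sum fun p hp => ?_
        obtain ⟨h2, h3, h4⟩ := hP p hp
        rw [← Set.ncard_eq_toFinset_card']
        exact le_ncard_coreBases h0 h1 hn h2 h4 h3
    _ ≤ _ := by exact_mod_cast hle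

end LowerBound

/-! ### Upper bounds for non-Type-4 and Hamiltonian bases. -/

section UpperBound

variable {n : ℕ}

/-- Arc sets of size `n + 1` without sources and sinks arise from permutations by moving one arc
and adding another one. -/
theorem exists_perm_of_no_source_no_sink {B : Finset (Arc n)} (hcard : B.card = n + 1)
    (hout : ∀ v, ∃ e ∈ B, e.tail = v) (hin : ∀ v, ∃ e ∈ B, e.head = v) :
    ∃ (σ : Equiv.Perm (Fin n)) (u t v : Fin n), ∀ e, e ∈ B ↔
      (e.tail ≠ u ∧ σ e.tail = e.head) ∨ e.1 = (u, t) ∨ e.1 = (v, σ u) := by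
  classical
  -- Two of the `n + 1` arcs share a tail. Without `e₀`, the other `n` arcs still have all nodes as
  -- tails, so they form the graph of a function `f`.
  obtain ⟨e₀, he₀, e₁, he₁, hne, htail⟩ : ∃ e₀ ∈ B, ∃ e₁ ∈ B, e₀ ≠ e₁ ∧ e₀.tail = e₁.tail :=
    Finset.exists_ne_map_eq_of_card_lt_of_maps_to (t := Finset.univ) (by simp [hcard])
      fun _ _ => Finset.mem_univ _
  have hout' : ∀ v, ∃ e ∈ B.erase e₀, e.tail = v := by
    intro v
    obtain ⟨e, he, hv⟩ := hout v
    by_cases h : e = e₀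
    · exact ⟨e₁, Finset.mem_erase.2 ⟨hne.symm, he₁⟩, by rw [← htail, ← h, hv]⟩
    · exact ⟨e, Finset.mem_erase.2 ⟨h, he⟩, hv⟩
  have hinj : Set.InjOn Arc.tail (B.erase e₀ : Set (Arc n)) := by
    refine Finset.injOn_of_surjOn_of_card_le (t := Finset.univ) _
      (fun _ _ => Finset.mem_coe.2 (Finset.mem_univ _)) (fun v _ => ?_) ?_
    · obtain ⟨e, he, hv⟩ := hout' v
      exact ⟨e, he, hv⟩
    · rw [Finset.card_erase_of_mem he₀, hcard]
      simp
  choose a ha hat using hout'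
  let f : Fin n → Fin n := fun v => (a v).head
  have hmem : ∀ e, e ∈ B ↔ f e.tail = e.head ∨ e = e₀ := by
    intro e
    constructor
    · intro he
      by_cases h : e = e₀
      · exact Or.inr h
      · have : a e.tail = e := hinj (ha _) (Finset.mem_erase.2 ⟨h, he⟩) (hat _)
        exact Or.inl (congrArg Arc.head this)
    · rintro (h | rfl)
      · have : a e.tail = e := Subtype.ext (Prod.ext (hat _) h)
        rw [← this]
        exact Finset.mem_of_mem_erase (ha _)
      · exact he₀
  have hrange : ∀ y, y ≠ e₀.head → ∃ z, f z = y := by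
    intro y hy
    obtain ⟨e, he, hv⟩ := hin y
    rcases (hmem e).1 he with h | rfl
    · exact ⟨e.tail, h.trans hv⟩
    · exact absurd hv.symm hy
  -- Only `e₀.head` can be missing from the range of `f`. Redirecting to it one of two nodes with
  -- equal image gives a permutation; if `f` is already bijective, `u` is the preimage of `e₀.head`
  -- and nothing changes.
  obtain ⟨u, hu⟩ : ∃ u, Function.Surjective (Function.update f u e₀.head) := by
    by_cases hf : Function.Injective f
    · obtain ⟨u, hu⟩ := Finite.surjective_of_injective hf e₀.head
      refine ⟨u, ?_⟩
      rw [← hu, Function.update_eq_self]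
      exact Finite.surjective_of_injective hf
    · simp only [Function.Injective, not_forall] at hf
      obtain ⟨u, u', huu, hne'⟩ := hf
      refine ⟨u, fun y => ?_⟩
      by_cases hy : y = e₀.head
      · exact ⟨u, by simp [hy]⟩
      · obtain ⟨z, hz⟩ := hrange y hy
        by_cases hzu : z = u
        · exact ⟨u', by rw [Function.update_of_ne (Ne.symm hne'), ← huu, ← hzu, hz]⟩
        · exact ⟨z, by rw [Function.update_of_ne hzu, hz]⟩
  refine ⟨Equiv.ofBijective _ (Finite.surjective_iff_bijective.1 hu), u, f u, e₀.tail, fun e => ?_⟩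
  rw [hmem e]
  simp only [Equiv.ofBijective_apply, Function.update_self]
  have h1 : e = e₀ ↔ e.1 = (e₀.tail, e₀.head) := Subtype.ext_iff
  have h2 : e.1 = (u, f u) ↔ e.tail = u ∧ e.head = f u := Prod.ext_iff
  rw [h1, h2]
  by_cases hu' : e.tail = u
  · simp [hu', eq_comm]
  · simp [hu']

/-- The set is recovered from the permutation and the three nodes `u, t, v`. -/
theorem card_no_source_no_sink_le :
    {B : Finset (Arc n) | B.card = n + 1 ∧ (∀ v, ∃ e ∈ B, e.tail = v) ∧
      ∀ v, ∃ e ∈ B, e.head = v}.ncard ≤ n.factorial * n ^ 3 := by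
  classical
  let Φ : Equiv.Perm (Fin n) × Fin n × Fin n × Fin n → Finset (Arc n) := fun q =>
    Finset.univ.filter fun e => (e.tail ≠ q.2.1 ∧ q.1 e.tail = e.head) ∨ e.1 = (q.2.1, q.2.2.1) ∨
      e.1 = (q.2.2.2, q.1 q.2.1)
  have hsub : {B : Finset (Arc n) | B.card = n + 1 ∧ (∀ v, ∃ e ∈ B, e.tail = v) ∧
      ∀ v, ∃ e ∈ B, e.head = v} ⊆ Set.range Φ := by
    rintro B ⟨h1, h2, h3⟩
    obtain ⟨σ, u, t, v, h⟩ := exists_perm_of_no_source_no_sink h1 h2 h3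
    refine ⟨(σ, u, t, v), ?_⟩
    ext e
    simp [Φ, h e]
  refine (Set.ncard_le_ncard hsub (Set.toFinite _)).trans ?_
  rw [← Set.image_univ]
  refine (Set.ncard_image_le (Set.toFinite _)).trans ?_
  rw [Set.ncard_univ, Nat.card_eq_fintype_card]
  simp only [Fintype.card_prod, Fintype.card_perm, Fintype.card_fin]
  exact le_of_eq (by ring)

theorem balance_eq {β : ℝ} {x : Arc n → ℝ} (hx : (constraintMatrix n β).mulVec x = rhs n β)
    (v : Fin n) : (∑ e, if e.tail = v then x e else 0) - β * ∑ e, (if e.head = v then x e else 0) =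
      rhs n β (Sum.inl v) := by
  rw [← hx, Finset.mul_sum, ← Finset.sum_sub_distrib]
  refine Finset.sum_congr rfl fun e _ => ?_
  show _ = ((if e.tail = v then 1 else 0) - β * (if e.head = v then 1 else 0)) * x e
  split_ifs <;> ring

theorem exists_pos_of_sum_ne_zero {x : Arc n → ℝ} {q : Arc n → Prop} [DecidablePred q]
    (h : (∑ e, if q e then x e else 0) ≠ 0) : ∃ e ∈ supp x, q e := by
  obtain ⟨e, _, he⟩ := Finset.exists_ne_zero_of_sum_ne_zero h
  by_cases hq : q e
  · exact ⟨e, by simpa [hq, supp] using he, hq⟩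
  · simp [hq] at he

theorem sum_pos_of_mem_supp {x : Arc n → ℝ} (hx : ∀ e, 0 ≤ x e) {q : Arc n → Prop}
    [DecidablePred q] {e : Arc n} (he : e ∈ supp x) (hq : q e) :
    0 < ∑ e, if q e then x e else 0 := by
  have hnn : ∀ e, 0 ≤ if q e then x e else 0 := fun e => by
    split_ifs
    exacts [hx e, le_rfl]
  refine lt_of_lt_of_le ?_ (Finset.single_le_sum (fun e _ => hnn e) (Finset.mem_univ e))
  simpa [hq] using lt_of_le_of_ne (hx e) (Ne.symm he)

/-- Without nodes of degree zero, the support of a feasible point has no sources and sinks. -/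
theorem supp_no_source_no_sink [NeZero n] {β : ℝ} (h0 : 0 < β) {E : Set (Arc n)} {x : Arc n → ℝ}
    (hx : x ∈ polytope β E) (hdeg : ∀ v, ¬ HasDegreeZero (supp x) v) (v : Fin n) :
    (∃ e ∈ supp x, e.tail = v) ∧ ∃ e ∈ supp x, e.head = v := by
  obtain ⟨hA, hnn, -⟩ := hx
  have hbal := balance_eq hA v
  by_cases hv : v = 0
  · subst hv
    have hlast : (∑ e, if e.tail = (0 : Fin n) then x e else 0) = 1 := by
      have := congrFun hA (Sum.inr ())
      simpa [Matrix.mulVec, dotProduct, constraintMatrix_inr, rhs] using this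
    -- With outflow 1, zero inflow at node `0` would force `β ^ n = 0`.
    refine ⟨exists_pos_of_sum_ne_zero (by rw [hlast]; exact one_ne_zero),
      exists_pos_of_sum_ne_zero fun h => ?_⟩
    rw [hlast, h] at hbal
    have hpow := pow_pos h0 n
    simp [rhs] at hbal
    linarith
  -- Elsewhere outflow is `β` times inflow, so either one being positive makes the other positive.
  · have hr : rhs n β (Sum.inl v) = 0 := if_neg fun h => hv (Fin.ext (by simpa using h))
    rw [hr] at hbal
    have hd := hdeg v
    simp only [HasDegreeZero, not_forall] at hd
    obtain ⟨e, he, hev⟩ := hd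
    have hor : e.tail = v ∨ e.head = v := by
      by_contra hcon
      exact hev (not_or.1 hcon)
    rcases hor with h | h
    · have hpos := sum_pos_of_mem_supp hnn (q := fun e => e.tail = v) he h
      refine ⟨⟨e, he, h⟩, exists_pos_of_sum_ne_zero fun hz => ?_⟩
      rw [hz] at hbal
      linarith
    · have hpos := sum_pos_of_mem_supp hnn (q := fun e => e.head = v) he h
      refine ⟨exists_pos_of_sum_ne_zero fun hz => ?_, ⟨e, he, h⟩⟩
      rw [hz] at hbal
      have := mul_pos h0 hpos
      linarith

theorem IsBasisOf.supp_subset {β : ℝ} {E : Set (Arc n)} {B : Finset (Arc n)} {x : Arc n → ℝ}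
    (hx : IsBasisOf β E B x) : supp x ⊆ B := fun e he => by
  by_contra h
  exact he (hx.eq_zero e h)

theorem IsHamiltonianCycle.not_hasDegreeZero {S : Set (Arc n)} (hn : 2 ≤ n)
    (hS : IsHamiltonianCycle S) (v : Fin n) : ¬ HasDegreeZero S v := by
  obtain ⟨σ, hσ, rfl⟩ := hS
  have : Nontrivial (Fin n) := Fin.nontrivial_iff_two_le.2 hn
  have hne : σ v ≠ v := hσ.apply_ne Set.nontrivial_univ (Set.mem_univ v)
  intro h
  exact (h ⟨(v, σ v), hne.symm⟩ rfl).1 rfl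

/-- An upper bound for the number of feasible bases that are not of Type 4. -/
theorem ncard_not_typeFour_le (hn : 2 ≤ n) {β : ℝ} (h0 : 0 < β) :
    {B : Finset (Arc n) | IsFeasibleBasis β Set.univ B ∧ ¬ IsTypeFourBasis β Set.univ B}.ncard ≤
      n.factorial * n ^ 3 := by
  have : NeZero n := ⟨by omega⟩
  refine (Set.ncard_le_ncard ?_ (Set.toFinite _)).trans card_no_source_no_sink_le
  rintro B ⟨⟨x, hx⟩, hB⟩
  have hdeg : ∀ v, ¬ HasDegreeZero (supp x) v := by
    by_cases hH : IsHamiltonianCycle (supp x)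
    · exact hH.not_hasDegreeZero hn
    · intro v hv
      exact hB ⟨x, hx, hH, v, hv⟩
  have h := supp_no_source_no_sink h0 hx.mem hdeg
  refine ⟨hx.card, fun v => ?_, fun v => ?_⟩
  · obtain ⟨e, he, hv⟩ := (h v).1
    exact ⟨e, hx.supp_subset he, hv⟩
  · obtain ⟨e, he, hv⟩ := (h v).2
    exact ⟨e, hx.supp_subset he, hv⟩

/-- A Hamiltonian basis is a Hamiltonian cycle together with one more arc. -/
theorem IsHamiltonianBasis.exists_perm (hn : 2 ≤ n) {β : ℝ} {E : Set (Arc n)} {B : Finset (Arc n)}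
    (hB : IsHamiltonianBasis β E B) : ∃ (σ : Equiv.Perm (Fin n)) (a : Fin n × Fin n),
      ∀ e, e ∈ B ↔ σ e.tail = e.head ∨ e.1 = a := by
  classical
  obtain ⟨x, hx, σ, hσ, hS⟩ := hB
  have : Nontrivial (Fin n) := Fin.nontrivial_iff_two_le.2 hn
  have hne : ∀ v, σ v ≠ v := fun v => hσ.apply_ne Set.nontrivial_univ (Set.mem_univ v)
  let C : Finset (Arc n) := Finset.univ.image fun v => ⟨(v, σ v), (hne v).symm⟩
  have hC : ∀ e, e ∈ C ↔ σ e.tail = e.head := by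
    intro e
    simp only [C, Finset.mem_image, Finset.mem_univ, true_and]
    constructor
    · rintro ⟨v, rfl⟩
      rfl
    · intro h
      exact ⟨e.tail, Subtype.ext (Prod.ext rfl h)⟩
  have hCcard : C.card = n := by
    rw [Finset.card_image_of_injective, Finset.card_univ, Fintype.card_fin]
    intro v w h
    exact congrArg Arc.tail h
  have hsub : C ⊆ B := by
    intro e he
    have h1 : e ∈ supp x := by
      rw [hS]
      exact (hC e).1 he
    exact hx.supp_subset h1
  have hone : (B \ C).card = 1 := by
    rw [Finset.card_sdiff_of_subset hsub, hx.card, hCcard]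
    omega
  obtain ⟨a, ha⟩ := Finset.card_eq_one.1 hone
  refine ⟨σ, a.1, fun e => ?_⟩
  rw [← hC, ← Subtype.ext_iff, ← Finset.mem_singleton, ← ha, Finset.mem_sdiff]
  constructor
  · intro h
    by_cases h' : e ∈ C
    exacts [Or.inl h', Or.inr ⟨h, h'⟩]
  · rintro (h | h)
    exacts [hsub h, h.1]

/-- An upper bound for the number of Hamiltonian bases. -/
theorem ncard_isHamiltonianBasis_le (hn : 2 ≤ n) (β : ℝ) (E : Set (Arc n)) :
    {B : Finset (Arc n) | IsHamiltonianBasis β E B}.ncard ≤ n.factorial * n ^ 2 := by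
  classical
  let Φ : Equiv.Perm (Fin n) × Fin n × Fin n → Finset (Arc n) := fun q =>
    Finset.univ.filter fun e => q.1 e.tail = e.head ∨ e.1 = q.2
  have hsub : {B : Finset (Arc n) | IsHamiltonianBasis β E B} ⊆ Set.range Φ := by
    rintro B hB
    obtain ⟨σ, a, h⟩ := IsHamiltonianBasis.exists_perm hn hB
    refine ⟨(σ, a), ?_⟩
    ext e
    simp [Φ, h e]
  refine (Set.ncard_le_ncard hsub (Set.toFinite _)).trans ?_
  rw [← Set.image_univ]
  refine (Set.ncard_image_le (Set.toFinite _)).trans ?_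
  rw [Set.ncard_univ, Nat.card_eq_fintype_card]
  simp only [Fintype.card_prod, Fintype.card_perm, Fintype.card_fin]
  exact le_of_eq (by ring)

end UpperBound

/-! ### Reduction from the random to the complete digraph. -/

section Expectation

variable {n : ℕ}

theorem measurableSet_superset (B : Finset (Arc n)) :
    MeasurableSet {E : Set (Arc n) | (B : Set (Arc n)) ⊆ E} := by
  have : {E : Set (Arc n) | (B : Set (Arc n)) ⊆ E} = ⋂ e ∈ B, {E : Set (Arc n) | e ∈ E} := by
    ext E
    simp [Set.subset_def]
  rw [this]
  exact Finset.measurableSet_biInter _ fun e _ => measurableSet_setOfPred.2 (measurable_set_mem e)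

/-- The probability that the random digraph contains given arcs. -/
theorem binomialDigraph_real_superset (p : unitInterval) (B : Finset (Arc n)) :
    (binomialDigraph n p).real {E | (B : Set (Arc n)) ⊆ E} = (p : ℝ) ^ B.card := by
  -- The event is a cylinder of the product measure.
  have h : (fun q : Arc n → Prop => {e | q e}) ⁻¹' {E | (B : Set (Arc n)) ⊆ E} =
      Set.pi (B : Set (Arc n)) fun _ => {True} := by
    ext q
    simp [Set.subset_def, Set.mem_pi]
  rw [measureReal_def, binomialDigraph, setBernoulli_apply', h,
    Measure.infinitePi_pi _ fun _ _ => MeasurableSet.of_discrete]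
  simp

/-- The expected number of arc sets of size `n + 1` in the random digraph that have a given
property. -/
theorem expectedCount_eq (p : unitInterval) (P : Set (Arc n) → Finset (Arc n) → Prop)
    (hP : ∀ E B, P E B ↔ (B : Set (Arc n)) ⊆ E ∧ P Set.univ B)
    (hcard : ∀ B, P Set.univ B → B.card = n + 1) :
    expectedCount n p P = (p : ℝ) ^ (n + 1) * ({B | P Set.univ B}.ncard : ℝ) := by
  classical
  have : IsProbabilityMeasure (binomialDigraph n p) := by
    unfold binomialDigraph
    infer_instance
  -- The count is a sum of indicators of `B ⊆ E`, to which linearity of expectation applies.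
  have hcount : ∀ E, ({B | P E B}.ncard : ℝ) = ∑ B ∈ {B | P Set.univ B}.toFinset,
      Set.indicator {E : Set (Arc n) | (B : Set (Arc n)) ⊆ E} (fun _ => (1 : ℝ)) E := by
    intro E
    rw [Set.ncard_eq_toFinset_card']
    simp only [Set.indicator_apply, Set.mem_ofPred_eq, Finset.sum_boole]
    congr 2
    ext B
    simp only [Set.mem_toFinset, Set.mem_ofPred_eq, Finset.mem_filter]
    rw [hP E B, and_comm]
  rw [expectedCount, integral_congr_ae (Filter.Eventually.of_forall hcount)]
  rw [integral_finsetSum _ fun B _ =>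
    (integrable_const (1 : ℝ)).indicator (measurableSet_superset B)]
  rw [Set.ncard_eq_toFinset_card', mul_comm, ← nsmul_eq_mul, ← Finset.sum_const]
  refine Finset.sum_congr rfl fun B hB => ?_
  rw [integral_indicator_const _ (measurableSet_superset B), binomialDigraph_real_superset,
    hcard B (Set.mem_toFinset.1 hB), smul_eq_mul, mul_one]

/-- Since `x` vanishes off `B`, its vanishing off `E` follows from `B ⊆ E`. -/
theorem isBasisOf_iff {β : ℝ} {E : Set (Arc n)} {B : Finset (Arc n)} {x : Arc n → ℝ} :
    IsBasisOf β E B x ↔ (B : Set (Arc n)) ⊆ E ∧ IsBasisOf β Set.univ B x := by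
  constructor
  · intro h
    exact ⟨h.subset, Set.subset_univ _, h.card, h.linearIndependent,
      ⟨h.mem.1, h.mem.2.1, fun e he => absurd (Set.mem_univ e) he⟩, h.eq_zero⟩
  · rintro ⟨h1, h⟩
    exact ⟨h1, h.card, h.linearIndependent,
      ⟨h.mem.1, h.mem.2.1, fun e he => h.eq_zero e fun heB => he (h1 heB)⟩, h.eq_zero⟩

theorem exists_isBasisOf_iff {β : ℝ} (E : Set (Arc n)) (B : Finset (Arc n))
    (q : (Arc n → ℝ) → Prop) : (∃ x, IsBasisOf β E B x ∧ q x) ↔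
      (B : Set (Arc n)) ⊆ E ∧ ∃ x, IsBasisOf β Set.univ B x ∧ q x := by
  simp only [isBasisOf_iff (E := E), and_assoc, exists_and_left]

theorem expectedCount_isFeasibleBasis (β : ℝ) (p : unitInterval) :
    expectedCount n p (IsFeasibleBasis β) =
      (p : ℝ) ^ (n + 1) * ({B : Finset (Arc n) | IsFeasibleBasis β Set.univ B}.ncard : ℝ) :=
  expectedCount_eq p _
    (fun E B => by simpa [IsFeasibleBasis] using exists_isBasisOf_iff (β := β) E B fun _ => True)
    fun _ ⟨_, h⟩ => h.card

theorem expectedCount_isHamiltonianBasis (β : ℝ) (p : unitInterval) :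
    expectedCount n p (IsHamiltonianBasis β) =
      (p : ℝ) ^ (n + 1) * ({B : Finset (Arc n) | IsHamiltonianBasis β Set.univ B}.ncard : ℝ) :=
  expectedCount_eq p _ (fun E B => exists_isBasisOf_iff E B _) fun _ ⟨_, h, _⟩ => h.card

theorem expectedCount_isTypeFourBasis (β : ℝ) (p : unitInterval) :
    expectedCount n p (IsTypeFourBasis β) =
      (p : ℝ) ^ (n + 1) * ({B : Finset (Arc n) | IsTypeFourBasis β Set.univ B}.ncard : ℝ) :=
  expectedCount_eq p _ (fun E B => exists_isBasisOf_iff E B _) fun _ ⟨_, h, _⟩ => h.card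

theorem ncard_isTypeFourBasis_add (β : ℝ) :
    {B : Finset (Arc n) | IsTypeFourBasis β Set.univ B}.ncard +
      {B : Finset (Arc n) | IsFeasibleBasis β Set.univ B ∧ ¬ IsTypeFourBasis β Set.univ B}.ncard =
      {B : Finset (Arc n) | IsFeasibleBasis β Set.univ B}.ncard := by
  rw [← Set.ncard_union_eq (Set.disjoint_left.2 fun B h h' => h'.2 h) (Set.toFinite _)
    (Set.toFinite _)]
  congr 1
  ext B
  simp only [Set.mem_union, Set.mem_ofPred_eq]
  constructor
  · rintro (⟨x, h, -⟩ | h)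
    exacts [⟨x, h⟩, h.1]
  · intro h
    by_cases h4 : IsTypeFourBasis β Set.univ B
    exacts [Or.inl h4, Or.inr ⟨h, h4⟩]

end Expectation

/-! ### Stirling's bound and elementary estimates. -/

section Estimates

/-- The Stirling sequence decreases from its value `e / √2` at 1. -/
theorem factorial_mul_exp_le {n : ℕ} (hn : 1 ≤ n) :
    (n.factorial : ℝ) * Real.exp n ≤ Real.exp 1 * (√n * (n : ℝ) ^ n) := by
  obtain ⟨k, rfl⟩ : ∃ k, n = k + 1 := ⟨n - 1, by omega⟩
  have h := Stirling.stirlingSeq'_antitone (Nat.zero_le k)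
  simp only [Function.comp_apply, Nat.succ_eq_add_one, zero_add, Stirling.stirlingSeq_one] at h
  rw [Stirling.stirlingSeq, div_le_iff₀ (by positivity), div_pow, ← Real.exp_nat_mul, mul_one,
    Real.sqrt_mul zero_le_two] at h
  have h2 : (√2 : ℝ) ≠ 0 := by positivity
  have h3 : Real.exp 1 / √2 * (√2 * √((k + 1 : ℕ) : ℝ) *
      (((k + 1 : ℕ) : ℝ) ^ (k + 1) / Real.exp ((k + 1 : ℕ) : ℝ))) =
      Real.exp 1 * (√((k + 1 : ℕ) : ℝ) * ((k + 1 : ℕ) : ℝ) ^ (k + 1)) / Real.exp ((k + 1 : ℕ) : ℝ) := by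
    field_simp
  rw [h3, le_div_iff₀ (Real.exp_pos _)] at h
  exact h

theorem rpow_add_half {x : ℝ} (hx : 0 < x) (k : ℕ) : x ^ ((k : ℝ) + 1 / 2) = x ^ k * √x := by
  rw [Real.rpow_add hx, Real.rpow_natCast, Real.sqrt_eq_rpow]

theorem two_zpow_sub_nine {n : ℕ} (hn : 3 ≤ n) :
    (2 : ℝ) ^ ((n : ℤ) - 9) = 2 ^ (n - 3) / 64 := by
  have : (n : ℤ) - 9 = ((n - 3 : ℕ) : ℤ) - 6 := by omega
  rw [this, zpow_sub₀ two_ne_zero, zpow_natCast]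
  norm_num

/-- For `n ≥ 6`, `(n - 1) * (n - 2)` is at least `n ^ 2 / 2`; this is the source of the threshold 6
in the theorem. -/
theorem lower_bound_simplify {n : ℕ} (hn : 6 ≤ n) :
    3 / 2 * ((n : ℝ) ^ (n - 2) * 2 ^ (n - 3)) ≤
      ((n : ℝ) - 1) * (n - 2) * ((n : ℝ) ^ (n - 3) * (3 / n) * 2 ^ (n - 3)) := by
  have h6 : (6 : ℝ) ≤ n := by exact_mod_cast hn
  have hpos : (0 : ℝ) < n := by linarith
  have hsq : (n : ℝ) ^ 2 / 2 ≤ ((n : ℝ) - 1) * (n - 2) := by nlinarith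
  have he : (n : ℝ) ^ (n - 2) = (n : ℝ) ^ (n - 3) * n := by
    rw [← pow_succ]
    congr 1
    omega
  calc 3 / 2 * ((n : ℝ) ^ (n - 2) * 2 ^ (n - 3))
      = (n : ℝ) ^ 2 / 2 * ((n : ℝ) ^ (n - 3) * (3 / n) * 2 ^ (n - 3)) := by
        rw [he]
        field_simp
    _ ≤ _ := by gcongr

end Estimates

end HBeta

theorem mainTheorem5 :
    ∃ N : ℕ, ∀ n : ℕ, N ≤ n → ∀ β : ℝ, 0 < β → β < 1 → ∀ p : unitInterval, 0 < p →
      1 - (n : ℝ) ^ (11 / 2 : ℝ) / (Real.exp n * (2 : ℝ) ^ ((n : ℤ) - 9)) ≤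
          HBeta.expectedCount n p (HBeta.IsTypeFourBasis β) /
            HBeta.expectedCount n p (HBeta.IsFeasibleBasis β) ∧
      HBeta.expectedCount n p (HBeta.IsHamiltonianBasis β) /
          HBeta.expectedCount n p (HBeta.IsFeasibleBasis β) ≤
        (n : ℝ) ^ (9 / 2 : ℝ) / (Real.exp ((n : ℝ) - 1) * (2 : ℝ) ^ ((n : ℤ) - 9)) := by
  refine ⟨6, fun n hn β h0 h1 p hp => ?_⟩
  have : NeZero n := ⟨by omega⟩
  have hnpos : (0 : ℝ) < n := by exact_mod_cast (show 0 < n by omega)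
  have hp' : (0 : ℝ) < p := hp
  have hppow : (p : ℝ) ^ (n + 1) ≠ 0 := (pow_pos hp' _).ne'
  rw [HBeta.expectedCount_isTypeFourBasis, HBeta.expectedCount_isFeasibleBasis,
    HBeta.expectedCount_isHamiltonianBasis, mul_div_mul_left _ _ hppow, mul_div_mul_left _ _ hppow,
    HBeta.two_zpow_sub_nine (by omega)]
  have hadd := HBeta.ncard_isTypeFourBasis_add (n := n) β
  have hNF := HBeta.ncard_not_typeFour_le (n := n) (by omega) h0
  have hH := HBeta.ncard_isHamiltonianBasis_le (n := n) (by omega) β Set.univ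
  have hT := (HBeta.lower_bound_simplify hn).trans
    (HBeta.le_ncard_isFeasibleBasis (n := n) h0 h1 (by omega))
  have hfac := HBeta.factorial_mul_exp_le (n := n) (by omega)
  generalize {B : Finset (HBeta.Arc n) | HBeta.IsTypeFourBasis β Set.univ B}.ncard = F at *
  generalize {B : Finset (HBeta.Arc n) |
    HBeta.IsFeasibleBasis β Set.univ B ∧ ¬ HBeta.IsTypeFourBasis β Set.univ B}.ncard = M at *
  generalize {B : Finset (HBeta.Arc n) | HBeta.IsFeasibleBasis β Set.univ B}.ncard = T at *
  generalize {B : Finset (HBeta.Arc n) | HBeta.IsHamiltonianBasis β Set.univ B}.ncard = H at *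
  have hTpos : (0 : ℝ) < T := lt_of_lt_of_le (by positivity) hT
  have hpow : (n : ℝ) ^ n = (n : ℝ) ^ (n - 2) * (n : ℝ) ^ 2 := by
    rw [← pow_add]
    congr 1
    omega
  have hNF' : (M : ℝ) ≤ n.factorial * (n : ℝ) ^ 3 := by exact_mod_cast hNF
  have hH' : (H : ℝ) ≤ n.factorial * (n : ℝ) ^ 2 := by exact_mod_cast hH
  have he3 : Real.exp 1 < 3 := Real.exp_one_lt_three
  constructor
  · have hF : (F : ℝ) = T - M := by
      rw [← hadd]
      push_cast
      ring
    rw [hF, sub_div, div_self hTpos.ne']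
    refine sub_le_sub_left ?_ _
    rw [div_le_div_iff₀ hTpos (by positivity), show (11 / 2 : ℝ) = ((5 : ℕ) : ℝ) + 1 / 2 by norm_num,
      HBeta.rpow_add_half hnpos]
    calc (M : ℝ) * (Real.exp n * (2 ^ (n - 3) / 64))
        ≤ (n.factorial * (n : ℝ) ^ 3) * (Real.exp n * (2 ^ (n - 3) / 64)) := by gcongr
      _ = (n.factorial * Real.exp n) * ((n : ℝ) ^ 3 * (2 ^ (n - 3) / 64)) := by ring
      _ ≤ (Real.exp 1 * (√n * (n : ℝ) ^ n)) * ((n : ℝ) ^ 3 * (2 ^ (n - 3) / 64)) := by gcongr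
      _ = Real.exp 1 / 64 * (n : ℝ) ^ 5 * (√n * ((n : ℝ) ^ (n - 2) * 2 ^ (n - 3))) := by
        rw [hpow]
        ring
      -- There is ample slack: `e / 64` is replaced by the constant `3 / 2` of the lower bound for
      -- `T`.
      _ ≤ 3 / 2 * (n : ℝ) ^ 5 * (√n * ((n : ℝ) ^ (n - 2) * 2 ^ (n - 3))) := by
        gcongr ?_ * _ * _
        linarith
      _ = (n : ℝ) ^ 5 * √n * (3 / 2 * ((n : ℝ) ^ (n - 2) * 2 ^ (n - 3))) := by ring
      _ ≤ (n : ℝ) ^ 5 * √n * T := by gcongr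
  · rw [div_le_div_iff₀ hTpos (by positivity), show (9 / 2 : ℝ) = ((4 : ℕ) : ℝ) + 1 / 2 by norm_num,
      HBeta.rpow_add_half hnpos, Real.exp_sub]
    calc (H : ℝ) * (Real.exp n / Real.exp 1 * (2 ^ (n - 3) / 64))
        ≤ (n.factorial * (n : ℝ) ^ 2) * (Real.exp n / Real.exp 1 * (2 ^ (n - 3) / 64)) := by gcongr
      _ = (n.factorial * Real.exp n) * ((n : ℝ) ^ 2 / Real.exp 1 * (2 ^ (n - 3) / 64)) := by ring
      _ ≤ (Real.exp 1 * (√n * (n : ℝ) ^ n)) *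
          ((n : ℝ) ^ 2 / Real.exp 1 * (2 ^ (n - 3) / 64)) := by gcongr
      _ = 1 / 64 * (n : ℝ) ^ 4 * (√n * ((n : ℝ) ^ (n - 2) * 2 ^ (n - 3))) := by
        rw [hpow]
        field_simp
      _ ≤ 3 / 2 * (n : ℝ) ^ 4 * (√n * ((n : ℝ) ^ (n - 2) * 2 ^ (n - 3))) := by
        gcongr ?_ * _ * _
        norm_num
      _ = (n : ℝ) ^ 4 * √n * (3 / 2 * ((n : ℝ) ^ (n - 2) * 2 ^ (n - 3))) := by ring
      _ ≤ (n : ℝ) ^ 4 * √n * T := by gcongr
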